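/- Let $n\ge 1$, $t>0$ and $x_0=(x_{10},\dots,x_{n0})\in\mathbb{R}^n$. Consider the $n$-th order integrator $$\dot x_k=x_{k+1}\ (1\le k\le n-1),\qquad \dot x_n=u,\qquad x(0)=x_0,$$ and let $u_{\min},u_{\max}:[0,t]\to\mathbb{R}$ be continuous with $u_{\min}\le u_{\max}$. The reach set $\mathcal{X}_t(\{x_0\})\subset\mathbb{R}^n$ is the set of all states $x(t)$ of solutions with a continuous input $u:[0,t]\to\mathbb{R}$ satisfying $u_{\min}(s)\le u(s)\le u_{\max}(s)$ for all $s\in[0,t]$. Put $$\chi_k(t,x_0)=\sum_{\ell=k}^{n}\frac{t^{\ell-k}}{(\ell-k)!}\,x_{\ell 0}\ (1\le k\le n),\qquad \xi(s)=\Big(\tfrac{s^{n-1}}{(n-1)!},\tfrac{s^{n-2}}{(n-2)!},\dots,s,1\Big)^{\top},$$ $$\mu(s)=\tfrac12\big(u_{\max}(s)-u_{\min}(s)\big),\qquad \nu(s)=\tfrac12\big(u_{\max}(s)+u_{\min}(s)\big),$$ and let $\mathcal{W}_t=\{\sigma\in\mathbb{R}^{n-1}: 0\le\sigma_1\le\dots\le\sigma_{n-1}\le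 t\}$. With $\sigma_0:=0$ and $\sigma_n:=t$, define for $\sigma\in\mathcal{W}_t$ $$x^{\pm}(\sigma)=\chi(t,x_0)+\int_0^t\nu(s)\,\xi(t-s)\,ds\;\pm\;\sum_{k=0}^{n-1}(-1)^{k}\int_{\sigma_{k}}^{\sigma_{k+1}}\mu(s)\,\xi(t-s)\,ds .$$ Then the topological boundary of the reach set is $$\partial\mathcal{X}_t(\{x_0\})=\{x^{+}(\sigma):\sigma\in\mathcal{W}_t\}\cup\{x^{-}(\sigma):\sigma\in\mathcal{W}_t\}.$$ In particular, this holds for the input range induced by a controllable system $\dot z=Az+bv$, $z(0)=z_0$, with $A\in\mathbb{R}^{n\times n}$, $b\in\mathbb{R}^n$ and constant input bounds $v_{\min}\le v_{\max}$, as follows. Let $q^{\top}$ be the last row of the inverse of the controllability matrix $(b,Ab,\dots,A^{n-1}b)$, let $M$ be the matrix with rows $q^{\top},q^{\top}A,\dots,q^{\top}A^{n-1}$, let $c=(c_0,\dots,c_{n-1})^{\top}$ where $\lambda^n+c_{n-1}\lambda^{n-1}+\dots+c_0$ is the characteristic polynomial of $A$, let $A_{\rm con}$ be the companion matrix with ones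 on the superdiagonal, last row $-c^{\top}$ and zeros elsewhere, and let $b_{\rm con}=(0,\dots,0,1)^{\top}$. Take $x_0=Mz_0$ and, for $s\in[0,t]$, with $f_s(\tau)=\langle c,e^{(s-\tau)A_{\rm con}}b_{\rm con}\rangle$, $$u_{\min}(s)=-\langle c,e^{sA_{\rm con}}Mz_0\rangle+v_{\min}-v_{\min}\int_{\{\tau\in[0,s]:f_s(\tau)\le 0\}}f_s(\tau)\,d\tau-v_{\max}\int_{\{\tau\in[0,s]:f_s(\tau)>0\}}f_s(\tau)\,d\tau,$$ $$u_{\max}(s)=-\langle c,e^{sA_{\rm con}}Mz_0\rangle+v_{\max}-v_{\max}\int_{\{\tau\in[0,s]:f_s(\tau)\le 0\}}f_s(\tau)\,d\tau-v_{\min}\int_{\{\tau\in[0,s]:f_s(\tau)>0\}}f_s(\tau)\,d\tau.$$ -/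

import Mathlib

open Set MeasureTheory
open scoped Matrix Nat

/-! The state dimension is `n = m + 1 ≥ 1`.  States are vectors `Fin (m + 1) → ℝ`, whose topology is
the usual one of `ℝⁿ`.  The coordinate with (one-based) number `k` is the index `k - 1`. -/

namespace LTIReach

noncomputable section

/-- The state matrix of the `n`-th order integrator: ones on the superdiagonal, zeros elsewhere. -/
def aInt (m : ℕ) : Matrix (Fin (m + 1)) (Fin (m + 1)) ℝ :=
  Matrix.of fun i j => if (j : ℕ) = (i : ℕ) + 1 then 1 else 0

/-- The input vector `(0, …, 0, 1)ᵀ`. -/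
def bCon (m : ℕ) : Fin (m + 1) → ℝ :=
  Pi.single (Fin.last m) 1

/-- The integrator reach set at time `t` from the initial state `x₀`: the endpoints `x t` of the
solutions of `ẋ = aInt x + bCon u`, `x 0 = x₀`, over all continuous inputs `u` on `[0, t]` with
`uMin s ≤ u s ≤ uMax s` for all `s ∈ [0, t]`. -/
def integratorReachSet {m : ℕ} (t : ℝ) (x₀ : Fin (m + 1) → ℝ) (uMin uMax : ℝ → ℝ) :
    Set (Fin (m + 1) → ℝ) :=
  {p | ∃ (u : ℝ → ℝ) (x : ℝ → Fin (m + 1) → ℝ),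
    ContinuousOn u (Icc 0 t) ∧
    (∀ s ∈ Icc 0 t, u s ∈ Icc (uMin s) (uMax s)) ∧
    x 0 = x₀ ∧
    (∀ s ∈ Icc 0 t,
      HasDerivWithinAt x (aInt m *ᵥ x s + u s • bCon m) (Icc 0 t) s) ∧
    x t = p}

/-- `χ_k(t, x₀) = ∑_ℓ 1_{k ≤ ℓ} t^(ℓ-k) / (ℓ-k)! x_{ℓ0}`. -/
def chi {m : ℕ} (t : ℝ) (x₀ : Fin (m + 1) → ℝ) : Fin (m + 1) → ℝ :=
  fun k => ∑ l : Fin (m + 1),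
    if k ≤ l then t ^ ((l : ℕ) - (k : ℕ)) / (((l : ℕ) - (k : ℕ))! : ℝ) * x₀ l else 0

/-- `ξ(s) = (s^(n-1)/(n-1)!, s^(n-2)/(n-2)!, …, s, 1)ᵀ`. -/
def xi (m : ℕ) (s : ℝ) : Fin (m + 1) → ℝ :=
  fun k => s ^ (m - (k : ℕ)) / ((m - (k : ℕ))! : ℝ)

/-- The Weyl chamber `0 ≤ σ_1 ≤ … ≤ σ_{n-1} ≤ t` in `ℝ^(n-1)`. -/
def weylChamber (m : ℕ) (t : ℝ) : Set (Fin m → ℝ) :=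
  {σ | Monotone σ ∧ ∀ i, σ i ∈ Icc 0 t}

/-- The half-width of the input range. -/
def mu (uMin uMax : ℝ → ℝ) (s : ℝ) : ℝ := (uMax s - uMin s) / 2

/-- The midpoint of the input range. -/
def nu (uMin uMax : ℝ → ℝ) (s : ℝ) : ℝ := (uMax s + uMin s) / 2

/-- The list of points `0, σ_1, …, σ_{n-1}, t`. -/
def knots {m : ℕ} (t : ℝ) (σ : Fin m → ℝ) : Fin (m + 2) → ℝ :=
  Fin.cons 0 (Fin.snoc σ t : Fin (m + 1) → ℝ)

/-- The parametric point with leading sign `ε`: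
`χ(t, x₀) + ∫_0^t ν ξ(t-s) ds + ε (∫_0^{σ_1} - ∫_{σ_1}^{σ_2} + … + (-1)^(n-1) ∫_{σ_{n-1}}^t) μ ξ(t-s) ds`.
-/
def boundaryPoint {m : ℕ} (t : ℝ) (x₀ : Fin (m + 1) → ℝ) (uMin uMax : ℝ → ℝ) (ε : ℝ)
    (σ : Fin m → ℝ) : Fin (m + 1) → ℝ :=
  chi t x₀ + (∫ s in (0 : ℝ)..t, nu uMin uMax s • xi m (t - s))
    + ε • ∑ k : Fin (m + 1), (-1 : ℝ) ^ (k : ℕ) •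
        ∫ s in (knots t σ k.castSucc)..(knots t σ k.succ), mu uMin uMax s • xi m (t - s)

/-! ### The input range induced by a controllable single-input LTI system `ż = A z + b v` -/

/-- The controllability matrix `(b, A b, …, A^(n-1) b)`. -/
def ctrb {m : ℕ} (A : Matrix (Fin (m + 1)) (Fin (m + 1)) ℝ) (b : Fin (m + 1) → ℝ) :
    Matrix (Fin (m + 1)) (Fin (m + 1)) ℝ :=
  Matrix.of fun i j => ((A ^ (j : ℕ)) *ᵥ b) i

/-- The pair `(A, b)` is controllable: its controllability matrix has full rank. -/
def IsControllable {m : ℕ} (A : Matrix (Fin (m + 1)) (Fin (m + 1)) ℝ) (b : Fin (m + 1) → ℝ) :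
    Prop :=
  (ctrb A b).rank = m + 1

/-- The matrix with rows `qᵀ, qᵀ A, …, qᵀ A^(n-1)`, where `qᵀ` is the last row of the inverse of the
controllability matrix. -/
def toCanonical {m : ℕ} (A : Matrix (Fin (m + 1)) (Fin (m + 1)) ℝ) (b : Fin (m + 1) → ℝ) :
    Matrix (Fin (m + 1)) (Fin (m + 1)) ℝ :=
  Matrix.of fun i => (ctrb A b)⁻¹ (Fin.last m) ᵥ* (A ^ (i : ℕ))

/-- The coefficients `(c_0, …, c_{n-1})` of the monic characteristic polynomial of `A`. -/
def charCoeffs {m : ℕ} (A : Matrix (Fin (m + 1)) (Fin (m + 1)) ℝ) : Fin (m + 1) → ℝ :=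
  fun i => A.charpoly.coeff (i : ℕ)

/-- The companion matrix: ones on the superdiagonal and last row `-cᵀ`. -/
def aCon {m : ℕ} (A : Matrix (Fin (m + 1)) (Fin (m + 1)) ℝ) :
    Matrix (Fin (m + 1)) (Fin (m + 1)) ℝ :=
  Matrix.of fun i j =>
    if i = Fin.last m then -charCoeffs A j else if (j : ℕ) = (i : ℕ) + 1 then 1 else 0

/-- `f(τ) = ⟨c, e^{(s-τ) A_con} b_con⟩`. -/
def kernelF {m : ℕ} (A : Matrix (Fin (m + 1)) (Fin (m + 1)) ℝ) (s τ : ℝ) : ℝ :=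
  charCoeffs A ⬝ᵥ (NormedSpace.exp ((s - τ) • aCon A) *ᵥ bCon m)

/-- The zero sublevel set of `f` over `[0, s]`. -/
def subLevel {m : ℕ} (A : Matrix (Fin (m + 1)) (Fin (m + 1)) ℝ) (s : ℝ) : Set ℝ :=
  {τ ∈ Icc 0 s | kernelF A s τ ≤ 0}

/-- The strict zero superlevel set of `f` over `[0, s]`. -/
def superLevel {m : ℕ} (A : Matrix (Fin (m + 1)) (Fin (m + 1)) ℝ) (s : ℝ) : Set ℝ :=
  {τ ∈ Icc 0 s | 0 < kernelF A s τ}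

def iMin {m : ℕ} (A : Matrix (Fin (m + 1)) (Fin (m + 1)) ℝ) (vMin vMax s : ℝ) : ℝ :=
  vMin - vMin * (∫ τ in subLevel A s, kernelF A s τ)
    - vMax * (∫ τ in superLevel A s, kernelF A s τ)

def iMax {m : ℕ} (A : Matrix (Fin (m + 1)) (Fin (m + 1)) ℝ) (vMin vMax s : ℝ) : ℝ :=
  vMax - vMax * (∫ τ in subLevel A s, kernelF A s τ)
    - vMin * (∫ τ in superLevel A s, kernelF A s τ)

/-- The lower end of the input range of the integrator in the coordinates `x = M z`. -/
def uMinLTI {m : ℕ} (A : Matrix (Fin (m + 1)) (Fin (m + 1)) ℝ) (b z₀ : Fin (m + 1) → ℝ)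
    (vMin vMax s : ℝ) : ℝ :=
  -(charCoeffs A ⬝ᵥ (NormedSpace.exp (s • aCon A) *ᵥ (toCanonical A b *ᵥ z₀)))
    + iMin A vMin vMax s

/-- The upper end of the input range of the integrator in the coordinates `x = M z`. -/
def uMaxLTI {m : ℕ} (A : Matrix (Fin (m + 1)) (Fin (m + 1)) ℝ) (b z₀ : Fin (m + 1) → ℝ)
    (vMin vMax s : ℝ) : ℝ :=
  -(charCoeffs A ⬝ᵥ (NormedSpace.exp (s • aCon A) *ᵥ (toCanonical A b *ᵥ z₀)))
    + iMax A vMin vMax s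

end

end LTIReach

namespace LTIReach

/-! ### Variation of constants for the integrator chain -/

section

variable {m : ℕ}

/-! By variation of constants the reachable points are `chi t x₀ + ∫ u(s) ξ(t-s) ds`, so the reach
set is convex. The coordinates of `ξ` are the monomials of degree at most `m` up to factorials. A
nonzero functional `f` therefore corresponds to a nonzero polynomial `q(r) = f(ξ(r))` of degree at
most `m`, and `f` is maximized over inputs by the bang-bang input `ν + μ · sign q(t-s)`, which has
at most `m` switches.

Each bang-bang endpoint is a limit of reachable points (`endpoint_bangBang_mem_closure`). Given `ε`
and `σ`, the polynomial `ε ∏ (X - (t - σ i))` supplies a functional attaining its maximum there, so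
the endpoint is not interior (`endpoint_bangBang_mem_frontier`).

Conversely, a frontier point `y` has a supporting functional, whose sign pattern gives a bang-bang
endpoint `z`. Since bang-bang inputs are discontinuous, neither `y` nor `z` need be reachable. The
equality `y = z` comes from a stability estimate (`norm_endpoint_bangBang_sub_le`): reachable points
nearly maximizing `f` lie near `z`, because `q` has finitely many zeros. No compactness of a space
of measurable inputs enters. -/

theorem chi_zero (x : Fin (m + 1) → ℝ) : chi 0 x = x := by
  funext k
  unfold chi
  rw [Finset.sum_eq_single k]
  · simp
  · intro l _ hl
    split_ifs with h
    · have : (l : ℕ) - (k : ℕ) ≠ 0 := by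
        have : k < l := lt_of_le_of_ne h (Ne.symm hl)
        have : (k : ℕ) < l := this
        omega
      simp [this]
    · rfl
  · simp

theorem chi_add (r : ℝ) (x y : Fin (m + 1) → ℝ) : chi r (x + y) = chi r x + chi r y := by
  funext k
  simp only [chi, Pi.add_apply, ← Finset.sum_add_distrib]
  refine Finset.sum_congr rfl fun l _ => ?_
  split_ifs <;> ring

theorem chi_smul_bCon (r u : ℝ) : chi r (u • bCon m) = u • xi m r := by
  funext k
  simp only [chi, xi, bCon, Pi.smul_apply, smul_eq_mul]
  rw [Finset.sum_eq_single (Fin.last m)]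
  · simp [Fin.le_last]; ring
  · intro l _ hl
    simp [hl]
  · simp

theorem aInt_mulVec_castSucc (x : Fin (m + 1) → ℝ) (i : Fin m) :
    (aInt m *ᵥ x) i.castSucc = x i.succ := by
  simp only [Matrix.mulVec, dotProduct, aInt, Matrix.of_apply]
  rw [Finset.sum_eq_single i.succ]
  · simp
  · intro j _ hj
    have : (j : ℕ) ≠ (i : ℕ) + 1 := fun h => hj (Fin.ext (by simpa using h))
    simp [this]
  · simp

theorem aInt_mulVec_last (x : Fin (m + 1) → ℝ) : (aInt m *ᵥ x) (Fin.last m) = 0 := by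
  simp only [Matrix.mulVec, dotProduct, aInt, Matrix.of_apply]
  refine Finset.sum_eq_zero fun j _ => ?_
  have : (j : ℕ) ≠ m + 1 := by omega
  simp [this]

theorem hasDerivAt_pow_div_factorial (r : ℝ) (j : ℕ) :
    HasDerivAt (fun r : ℝ => r ^ (j + 1) / ((j + 1)! : ℝ)) (r ^ j / (j ! : ℝ)) r := by
  have h := (hasDerivAt_pow (j + 1) r).div_const ((j + 1)! : ℝ)
  refine h.congr_deriv ?_
  have : (j ! : ℝ) ≠ 0 := by positivity
  rw [Nat.factorial_succ]
  push_cast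
  field_simp

/-- Along the drift, `chi` satisfies the defining differential equation of the flow. -/
theorem hasDerivWithinAt_chi_comp {S : Set ℝ} {t s : ℝ} {x : ℝ → Fin (m + 1) → ℝ}
    {x' : Fin (m + 1) → ℝ} (hx : HasDerivWithinAt x x' S s) :
    HasDerivWithinAt (fun s => chi (t - s) (x s))
      (chi (t - s) x' - chi (t - s) (aInt m *ᵥ x s)) S s := by
  rw [hasDerivWithinAt_pi]
  intro k
  have hr : HasDerivWithinAt (fun s : ℝ => t - s) (-1) S s := by
    simpa using (hasDerivWithinAt_id s S).const_sub t
  have hterm : ∀ l : Fin (m + 1), HasDerivWithinAt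
      (fun s => if k ≤ l then (t - s) ^ ((l : ℕ) - (k : ℕ)) / (((l : ℕ) - (k : ℕ))! : ℝ) * x s l
        else 0)
      ((if k ≤ l then (t - s) ^ ((l : ℕ) - (k : ℕ)) / (((l : ℕ) - (k : ℕ))! : ℝ) * x' l else 0)
        - (if k < l then (t - s) ^ ((l : ℕ) - (k : ℕ) - 1) / (((l : ℕ) - (k : ℕ) - 1)! : ℝ) * x s l
            else 0)) S s := by
    intro l
    have hxl := (hasDerivWithinAt_pi.1 hx) l
    rcases lt_trichotomy k l with h | h | h
    · have h' : (k : ℕ) < l := h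
      obtain ⟨j, hj⟩ : ∃ j, (l : ℕ) - (k : ℕ) = j + 1 := ⟨(l : ℕ) - k - 1, by omega⟩
      simp only [h.le, h, if_true, hj, Nat.add_sub_cancel]
      have := ((hasDerivAt_pow_div_factorial (t - s) j).comp_hasDerivWithinAt s hr).mul hxl
      refine this.congr_deriv ?_
      simp only [Function.comp]
      ring
    · subst h
      simpa using hxl
    · simp only [not_le.2 h, not_lt.2 h.le, if_false, sub_zero]
      exact hasDerivWithinAt_const ..
  have hsum := HasDerivWithinAt.fun_sum (u := Finset.univ) fun l _ => hterm l
  refine hsum.congr_deriv ?_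
  rw [Finset.sum_sub_distrib]
  simp only [Pi.sub_apply, chi]
  congr 1
  -- `aInt` shifts coordinates by one, so the two sums agree after an index shift: the term `l = 0`
  -- vanishes in one, the last term in the other.
  rw [Fin.sum_univ_succ, Fin.sum_univ_castSucc]
  simp only [aInt_mulVec_castSucc, aInt_mulVec_last, mul_zero, ite_self, add_zero, Fin.not_lt_zero,
    if_false, zero_add]
  refine Finset.sum_congr rfl fun l _ => ?_
  have h1 : k < l.succ ↔ k ≤ l.castSucc := by
    simp [Fin.lt_def, Fin.le_def]
  have h2 : ((l.succ : Fin (m + 1)) : ℕ) - (k : ℕ) - 1 = ((l.castSucc : Fin (m + 1)) : ℕ) - k := by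
    simp; omega
  simp only [h1, h2]

theorem continuous_xi : Continuous (xi m) := by
  unfold xi
  fun_prop

/-- Variation of constants: the endpoint reached at time `t` from `x₀` with input `w`. -/
noncomputable def endpoint (t : ℝ) (x₀ : Fin (m + 1) → ℝ) (w : ℝ → ℝ) : Fin (m + 1) → ℝ :=
  chi t x₀ + ∫ s in (0 : ℝ)..t, w s • xi m (t - s)

/-- The curve `chi (t - s) (x s)` joins `chi t (x 0)` to `x t`. The drift cancels in its derivative,
leaving `u s • xi m (t - s)` to integrate. -/
theorem eq_endpoint_of_solution {t : ℝ} (ht : 0 < t) {x : ℝ → Fin (m + 1) → ℝ} {u : ℝ → ℝ}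
    (hu : ContinuousOn u (Icc 0 t))
    (hx : ∀ s ∈ Icc 0 t, HasDerivWithinAt x (aInt m *ᵥ x s + u s • bCon m) (Icc 0 t) s) :
    x t = endpoint t (x 0) u := by
  have hd : ∀ s ∈ Icc 0 t, HasDerivWithinAt (fun s => chi (t - s) (x s))
      (u s • xi m (t - s)) (Icc 0 t) s := fun s hs => by
    refine (hasDerivWithinAt_chi_comp (t := t) (hx s hs)).congr_deriv ?_
    rw [chi_add, chi_smul_bCon, add_sub_cancel_left]
  have hint : IntervalIntegrable (fun s => u s • xi m (t - s)) volume 0 t := by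
    apply ContinuousOn.intervalIntegrable
    rw [uIcc_of_le ht.le]
    exact hu.smul (continuous_xi.comp (by fun_prop)).continuousOn
  have := intervalIntegral.integral_eq_sub_of_hasDeriv_right_of_le ht.le
    (fun s hs => (hd s hs).continuousWithinAt)
    (fun s hs => ((hd s (Ioo_subset_Icc_self hs)).hasDerivAt
      (Icc_mem_nhds hs.1 hs.2)).hasDerivWithinAt) hint
  rw [endpoint, this]
  simp [chi_zero]

/-- The iterated antiderivatives of `u` with initial values `a`. -/
noncomputable def iterInt (a : ℕ → ℝ) (u : ℝ → ℝ) : ℕ → ℝ → ℝ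
  | 0 => u
  | j + 1 => fun s => a j + ∫ r in (0 : ℝ)..s, iterInt a u j r

theorem hasDerivAt_iterInt {a : ℕ → ℝ} {u : ℝ → ℝ} {j : ℕ} (h : Continuous (iterInt a u j))
    (s : ℝ) : HasDerivAt (iterInt a u (j + 1)) (iterInt a u j s) s :=
  (h.integral_hasStrictDerivAt 0 s).hasDerivAt.const_add (a j)

theorem continuous_iterInt (a : ℕ → ℝ) {u : ℝ → ℝ} (hu : Continuous u) :
    ∀ j, Continuous (iterInt a u j)
  | 0 => hu
  | j + 1 => continuous_iff_continuousAt.2 fun s =>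
      (hasDerivAt_iterInt (continuous_iterInt a hu j) s).continuousAt

theorem exists_solution (x₀ : Fin (m + 1) → ℝ) {u : ℝ → ℝ} (hu : Continuous u) :
    ∃ x : ℝ → Fin (m + 1) → ℝ, x 0 = x₀ ∧
      ∀ s, HasDerivAt x (aInt m *ᵥ x s + u s • bCon m) s := by
  -- Integration starts from the last coordinate, hence the reversal. Indices `j > m` wrap around
  -- and are never used.
  let a : ℕ → ℝ := fun j => x₀ (Fin.rev (Fin.ofNat (m + 1) j))
  refine ⟨fun s k => iterInt a u ((Fin.rev k : ℕ) + 1) s, ?_, fun s => ?_⟩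
  · funext k
    have : Fin.ofNat (m + 1) (Fin.rev k : ℕ) = Fin.rev k := Fin.ofNat_val_eq_self _
    simp only [iterInt, a, this, Fin.rev_rev, intervalIntegral.integral_same, add_zero]
  · rw [hasDerivAt_pi]
    intro k
    refine (hasDerivAt_iterInt (continuous_iterInt a hu _) s).congr_deriv ?_
    refine Fin.lastCases ?_ (fun i => ?_) k
    · simp [aInt_mulVec_last, bCon, iterInt]
    · have h : ((Fin.rev i.castSucc : Fin (m + 1)) : ℕ) = ((Fin.rev i.succ : Fin (m + 1)) : ℕ) + 1 := by
        simp [Fin.val_rev]; omega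
      rw [Pi.add_apply, aInt_mulVec_castSucc, h]
      simp [bCon, Fin.castSucc_ne_last]

theorem mem_integratorReachSet_iff {t : ℝ} (ht : 0 < t) {x₀ : Fin (m + 1) → ℝ} {uMin uMax : ℝ → ℝ}
    {p : Fin (m + 1) → ℝ} :
    p ∈ integratorReachSet t x₀ uMin uMax ↔ ∃ u : ℝ → ℝ, ContinuousOn u (Icc 0 t) ∧
      (∀ s ∈ Icc 0 t, u s ∈ Icc (uMin s) (uMax s)) ∧ endpoint t x₀ u = p := by
  constructor
  · rintro ⟨u, x, hu, hb, rfl, hx, rfl⟩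
    exact ⟨u, hu, hb, (eq_endpoint_of_solution ht hu hx).symm⟩
  · rintro ⟨u, hu, hb, rfl⟩
    -- Extending the input constantly beyond `[0, t]` makes it continuous on all of `ℝ`.
    obtain ⟨x, hx0, hx⟩ := exists_solution x₀ (u := IccExtend ht.le ((Icc 0 t).domRestrict u))
      (hu.domRestrict.Icc_extend')
    have hx' : ∀ s ∈ Icc 0 t,
        HasDerivWithinAt x (aInt m *ᵥ x s + u s • bCon m) (Icc 0 t) s := fun s hs => by
      have := (hx s).hasDerivWithinAt (s := Icc 0 t)
      rwa [IccExtend_of_mem ht.le _ hs] at this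
    exact ⟨u, x, hu, hb, hx0, hx', by rw [eq_endpoint_of_solution ht hu hx', hx0]⟩

end

/-! ### Supporting functionals, polynomials and sign patterns -/

section

/-- A convex set in a finite-dimensional space has a supporting hyperplane at every frontier
point. -/
theorem exists_supporting_functional {E : Type*} [NormedAddCommGroup E] [NormedSpace ℝ E]
    [FiniteDimensional ℝ E] {C : Set E} (hC : Convex ℝ C) {y : E} (hy : y ∈ frontier C) :
    ∃ f : StrongDual ℝ E, f ≠ 0 ∧ ∀ a ∈ C, f a ≤ f y := by
  by_cases hint : (interior C).Nonempty
  · exact geometric_hahn_banach_of_nonempty_interior_point hC hy.2 hint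
  -- A flat `C` lies in a proper affine subspace, so some nonzero functional is constant on it and
  -- on its closure.
  · rw [hC.interior_nonempty_iff_affineSpan_eq_top] at hint
    obtain ⟨c, hc⟩ : C.Nonempty := closure_nonempty_iff.1 ⟨y, hy.1⟩
    have hcs : c ∈ affineSpan ℝ C := subset_affineSpan ℝ C hc
    rw [← AffineSubspace.direction_eq_top_iff_of_nonempty ⟨c, hcs⟩] at hint
    obtain ⟨ψ, hψ, hle⟩ := Submodule.exists_le_ker_of_lt_top _ (lt_top_iff_ne_top.2 hint)
    let f : StrongDual ℝ E := LinearMap.toContinuousLinearMap ψ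
    have hconst : ∀ a ∈ C, f a = f c := fun a ha => by
      have : ψ (a - c) = 0 :=
        hle (AffineSubspace.vsub_mem_direction (subset_affineSpan ℝ C ha) hcs)
      rw [map_sub, sub_eq_zero] at this
      exact this
    have hfy : f y = f c :=
      closure_minimal hconst (isClosed_singleton.preimage f.continuous) hy.1
    refine ⟨f, fun h => hψ ?_, fun a ha => by rw [hconst a ha, hfy]⟩
    ext x
    exact DFunLike.congr_fun h x

theorem notMem_interior_of_forall_le {E : Type*} [NormedAddCommGroup E] [NormedSpace ℝ E]
    {C : Set E} {f : StrongDual ℝ E} (hf : f ≠ 0) {y : E} (hy : ∀ a ∈ C, f a ≤ f y) :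
    y ∉ interior C := fun h => by
  have hmax : IsLocalMax f y := Filter.mem_of_superset (mem_interior_iff_mem_nhds.1 h) hy
  exact hf (hmax.hasFDerivAt_eq_zero f.hasFDerivAt)

theorem real_sign_mul (a b : ℝ) : Real.sign (a * b) = Real.sign a * Real.sign b := by
  rcases lt_trichotomy a 0 with ha | rfl | ha <;> rcases lt_trichotomy b 0 with hb | rfl | hb <;>
  simp [Real.sign_of_neg, Real.sign_of_pos, mul_pos_of_neg_of_neg, mul_neg_of_neg_of_pos,
    mul_neg_of_pos_of_neg, *]

theorem real_sign_prod {ι : Type*} (S : Finset ι) (a : ι → ℝ) :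
    Real.sign (∏ i ∈ S, a i) = ∏ i ∈ S, Real.sign (a i) := by
  classical
  induction S using Finset.induction_on with
  | empty => simp
  | insert i S hi ih => rw [Finset.prod_insert hi, Finset.prod_insert hi, real_sign_mul, ih]

theorem abs_real_sign_le_one (a : ℝ) : |Real.sign a| ≤ 1 := by
  rcases Real.sign_apply_eq a with h | h | h <;> simp [h]

theorem measurable_real_sign : Measurable Real.sign :=
  Measurable.ite measurableSet_Iio measurable_const
    (Measurable.ite measurableSet_Ioi measurable_const measurable_const)

variable {m : ℕ}

/-- The switching function with leading value `1` that changes sign at the entries of `σ`. -/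
noncomputable def switching (σ : Fin m → ℝ) (s : ℝ) : ℝ := ∏ i, Real.sign (σ i - s)

theorem abs_switching_le_one (σ : Fin m → ℝ) (s : ℝ) : |switching σ s| ≤ 1 := by
  rw [switching, Finset.abs_prod]
  exact Finset.prod_le_one (fun _ _ => abs_nonneg _) fun _ _ => abs_real_sign_le_one _

theorem measurable_switching (σ : Fin m → ℝ) : Measurable (switching σ) :=
  Finset.measurable_prod _ fun _ _ =>
    measurable_real_sign.comp (measurable_const.sub measurable_id)

open Polynomial in
/-- On `[0, t)` a polynomial of degree at most `m` has the sign pattern of a switching function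
with `m` switching times. -/
theorem exists_real_sign_eval_eq_switching {t : ℝ} (ht : 0 < t) (m : ℕ) :
    ∀ q : ℝ[X], q ≠ 0 → q.natDegree ≤ m → ∃ ε : ℝ, (ε = 1 ∨ ε = -1) ∧ ∃ σ : Fin m → ℝ,
      (∀ i, σ i ∈ Icc 0 t) ∧
      ∀ s ∈ Ico 0 t, Real.sign (q.eval (t - s)) = ε * switching σ s := by
  -- Without roots in `[0, t]` the sign is constant, and all switching times are parked at `t`. They
  -- have no effect on `[0, t)` but force `switching` to vanish at `t` when `m > 0`, hence the
  -- half-open interval.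
  have hno : ∀ (m : ℕ) (q : ℝ[X]), (∀ r ∈ Icc 0 t, ¬ q.IsRoot r) →
      ∃ ε : ℝ, (ε = 1 ∨ ε = -1) ∧ ∃ σ : Fin m → ℝ, (∀ i, σ i ∈ Icc 0 t) ∧
      ∀ s ∈ Ico 0 t, Real.sign (q.eval (t - s)) = ε * switching σ s := by
    intro m q hq
    have hconst : ∀ r ∈ Icc 0 t, Real.sign (q.eval r) = Real.sign (q.eval 0) := by
      intro r hr
      have h0 : q.eval 0 ≠ 0 := hq 0 ⟨le_rfl, ht.le⟩
      have h1 : q.eval r ≠ 0 := hq r hr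
      have hivt : ∀ z ∈ uIcc (q.eval 0) (q.eval r), z ≠ 0 := by
        intro z hz hz0
        obtain ⟨w, hw, hwz⟩ := intermediate_value_uIcc (q.continuous.continuousOn) hz
        rw [uIcc_of_le hr.1] at hw
        exact hq w ⟨hw.1, hw.2.trans hr.2⟩ (hwz.trans hz0)
      rcases h0.lt_or_gt with h0 | h0 <;> rcases h1.lt_or_gt with h1 | h1
      · rw [Real.sign_of_neg h0, Real.sign_of_neg h1]
      · exact absurd rfl (hivt 0 (mem_uIcc_of_le h0.le h1.le))
      · exact absurd rfl (hivt 0 (mem_uIcc_of_ge h1.le h0.le))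
      · rw [Real.sign_of_pos h0, Real.sign_of_pos h1]
    refine ⟨Real.sign (q.eval 0),
      (Real.sign_apply_eq_of_ne_zero _ (hq 0 ⟨le_rfl, ht.le⟩)).symm, fun _ => t,
      fun _ => ⟨ht.le, le_rfl⟩, fun s hs => ?_⟩
    have : switching (fun _ : Fin m => t) s = 1 := by
      simp [switching, Real.sign_of_pos (sub_pos.2 hs.2)]
    rw [this, mul_one, hconst _ ⟨(sub_pos.2 hs.2).le, by linarith [hs.1]⟩]
  induction m with
  | zero =>
    intro q hq hd
    refine hno 0 q fun r _ hr => hq ?_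
    rw [eq_C_of_natDegree_le_zero hd] at hr ⊢
    simpa [IsRoot] using hr
  | succ m ih =>
    intro q hq hd
    by_cases h : ∀ r ∈ Icc 0 t, ¬ q.IsRoot r
    · exact hno (m + 1) q h
    · push Not at h
      obtain ⟨r, hr, hroot⟩ := h
      obtain ⟨p, rfl⟩ := dvd_iff_isRoot.2 hroot
      have hp : p ≠ 0 := right_ne_zero_of_mul hq
      rw [natDegree_mul (X_sub_C_ne_zero r) hp, natDegree_X_sub_C] at hd
      obtain ⟨ε, hε, σ, hσ, hs⟩ := ih p hp (by omega)
      -- A root `r` in `[0, t]` becomes the switching time `t - r`, and its linear factor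
      -- contributes the sign of `(t - r) - s`.
      refine ⟨ε, hε, Fin.cons (t - r) σ, fun i => ?_, fun s hst => ?_⟩
      · refine Fin.cases ?_ (fun i => ?_) i
        · simpa using And.intro hr.2 hr.1
        · simpa using hσ i
      · rw [eval_mul, real_sign_mul, hs s hst]
        simp only [switching, Fin.prod_univ_succ, Fin.cons_zero, Fin.cons_succ, eval_sub, eval_X,
          eval_C]
        rw [show t - s - r = t - r - s by ring]
        ring

/-- Lets the unordered roots of a polynomial be sorted into the Weyl chamber. -/
theorem switching_comp_perm (σ : Fin m → ℝ) (e : Equiv.Perm (Fin m)) :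
    switching (σ ∘ e) = switching σ :=
  funext fun s => Equiv.prod_comp e fun i => Real.sign (σ i - s)

open Polynomial in
theorem exists_polynomial_of_functional (f : StrongDual ℝ (Fin (m + 1) → ℝ)) (hf : f ≠ 0) :
    ∃ q : ℝ[X], q ≠ 0 ∧ q.natDegree ≤ m ∧ ∀ r, f (xi m r) = q.eval r := by
  classical
  let η : Fin (m + 1) → ℝ := fun k => f (Pi.single k 1)
  have hη : ∀ x, f x = ∑ k, x k * η k := fun x => by
    conv_lhs => rw [pi_eq_sum_univ' x]
    simp [η]
  let q : ℝ[X] := ∑ k : Fin (m + 1), C (η k / ((m - (k : ℕ))! : ℝ)) * X ^ (m - (k : ℕ))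
  refine ⟨q, fun h => hf ?_, ?_, fun r => ?_⟩
  · have h0 : ∀ k, η k = 0 := by
      intro k
      have hc : q.coeff (m - (k : ℕ)) = 0 := by rw [h, coeff_zero]
      simp only [q, finsetSum_coeff, coeff_C_mul, coeff_X_pow] at hc
      rw [Finset.sum_eq_single k] at hc
      · simpa [Nat.factorial_ne_zero] using hc
      · intro l _ hl
        have : m - (k : ℕ) ≠ m - (l : ℕ) := fun h => hl (Fin.ext (by omega))
        simp [this]
      · simp
    ext x
    simp [hη, h0]
  · refine natDegree_sum_le_of_forall_le _ _ fun k _ => ?_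
    exact (natDegree_C_mul_X_pow_le _ _).trans (Nat.sub_le _ _)
  · rw [hη, eval_finsetSum]
    refine Finset.sum_congr rfl fun k _ => ?_
    simp only [xi, eval_mul, eval_C, eval_pow, eval_X]
    ring

open Polynomial in
theorem exists_functional_of_polynomial {q : ℝ[X]} (hq : q ≠ 0) (hd : q.natDegree ≤ m) :
    ∃ f : StrongDual ℝ (Fin (m + 1) → ℝ), f ≠ 0 ∧ ∀ r, f (xi m r) = q.eval r := by
  let f : StrongDual ℝ (Fin (m + 1) → ℝ) := ∑ k : Fin (m + 1),
    (((m - (k : ℕ))! : ℝ) * q.coeff (m - (k : ℕ))) • ContinuousLinearMap.proj (R := ℝ) k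
  have hf : ∀ r, f (xi m r) = q.eval r := fun r => by
    rw [eval_eq_sum_range' (Nat.lt_succ_of_le hd), ← Finset.sum_range_reflect,
      ← Fin.sum_univ_eq_sum_range (fun j => q.coeff (m + 1 - 1 - j) * r ^ (m + 1 - 1 - j))]
    simp only [f, sum_apply, smul_apply,
      ContinuousLinearMap.proj_apply, xi, smul_eq_mul, Nat.add_sub_cancel]
    refine Finset.sum_congr rfl fun k _ => ?_
    have : ((m - (k : ℕ))! : ℝ) ≠ 0 := by positivity
    field_simp
  refine ⟨f, fun h => hq (Polynomial.funext fun r => ?_), hf⟩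
  rw [← hf, h]
  simp

open Polynomial in
theorem exists_functional_sign_eq_switching {t ε : ℝ} (hε : ε = 1 ∨ ε = -1) (σ : Fin m → ℝ) :
    ∃ f : StrongDual ℝ (Fin (m + 1) → ℝ), f ≠ 0 ∧
      ∀ s, Real.sign (f (xi m (t - s))) = ε * switching σ s := by
  have hε0 : ε ≠ 0 := by rcases hε with rfl | rfl <;> norm_num
  have hεs : Real.sign ε = ε := by
    rcases hε with rfl | rfl <;> simp [Real.sign_neg]
  have hP : (∏ i, (X - C (t - σ i))).Monic := monic_prod_of_monic _ _ fun i _ => monic_X_sub_C _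
  obtain ⟨f, hf, hfq⟩ := exists_functional_of_polynomial (m := m)
    (q := C ε * ∏ i, (X - C (t - σ i)))
    (mul_ne_zero (C_ne_zero.2 hε0) hP.ne_zero)
    (by
        rw [natDegree_C_mul hε0, natDegree_prod_of_monic _ _ fun i _ => monic_X_sub_C _]
        simp only [natDegree_X_sub_C, Finset.sum_const, Finset.card_univ, Fintype.card_fin,
          smul_eq_mul, mul_one, le_refl])
  refine ⟨f, hf, fun s => ?_⟩
  rw [hfq, eval_mul, eval_C, eval_prod, real_sign_mul, hεs, real_sign_prod, switching]
  congr 1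
  refine Finset.prod_congr rfl fun i _ => ?_
  rw [eval_sub, eval_X, eval_C, show t - s - (t - σ i) = σ i - s by ring]

end

/-! ### Bang-bang inputs, convexity and approximation -/

section

variable {m : ℕ}

theorem knots_succ_castSucc (t : ℝ) (σ : Fin m → ℝ) (i : Fin m) :
    knots t σ i.castSucc.succ = σ i := by
  simp [knots]

theorem knots_zero (t : ℝ) (σ : Fin m → ℝ) : knots t σ 0 = 0 := rfl

theorem knots_last (t : ℝ) (σ : Fin m → ℝ) : knots t σ (Fin.last (m + 1)) = t := by
  rw [← Fin.succ_last]
  simp [knots]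

theorem knots_mem_Icc {t : ℝ} (ht : 0 < t) {σ : Fin m → ℝ} (hσ : σ ∈ weylChamber m t)
    (k : Fin (m + 2)) : knots t σ k ∈ Icc 0 t := by
  refine Fin.cases ⟨le_rfl, ht.le⟩ (fun k => ?_) k
  refine Fin.lastCases ?_ (fun i => ?_) k
  · rw [Fin.succ_last, knots_last]
    exact ⟨ht.le, le_rfl⟩
  · rw [knots_succ_castSucc]
    exact hσ.2 i

theorem monotone_knots {t : ℝ} (ht : 0 < t) {σ : Fin m → ℝ} (hσ : σ ∈ weylChamber m t) :
    Monotone (knots t σ) := by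
  rw [Fin.monotone_iff_le_succ]
  intro k
  refine Fin.lastCases ?_ (fun i => ?_) k
  · rw [Fin.succ_last, knots_last]
    exact (knots_mem_Icc ht hσ _).2
  · rw [knots_succ_castSucc]
    rcases Nat.eq_zero_or_pos (i : ℕ) with h | h
    · have : (i.castSucc.castSucc : Fin (m + 2)) = 0 := Fin.ext (by simpa using h)
      rw [this, knots_zero]
      exact (hσ.2 i).1
    · have : (i.castSucc.castSucc : Fin (m + 2)) =
          (⟨(i : ℕ) - 1, by omega⟩ : Fin m).castSucc.succ := Fin.ext (by simp; omega)
      rw [this, knots_succ_castSucc]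
      exact hσ.1 (Fin.le_def.2 (Nat.sub_le _ _))

theorem switching_eq_of_mem_Ioo {t : ℝ} (ht : 0 < t) {σ : Fin m → ℝ} (hσ : σ ∈ weylChamber m t)
    (k : Fin (m + 1)) {s : ℝ} (hs : s ∈ Ioo (knots t σ k.castSucc) (knots t σ k.succ)) :
    switching σ s = (-1) ^ (k : ℕ) := by
  have hfac : ∀ i : Fin m, Real.sign (σ i - s) = if (i : ℕ) < k then -1 else 1 := by
    intro i
    rw [← knots_succ_castSucc t σ i]
    split_ifs with h
    · refine Real.sign_of_neg (sub_neg.2 (lt_of_le_of_lt (monotone_knots ht hσ ?_) hs.1))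
      simpa [Fin.le_def] using h
    · refine Real.sign_of_pos (sub_pos.2 (lt_of_lt_of_le hs.2 (monotone_knots ht hσ ?_)))
      simpa [Fin.le_def] using h
  simp only [switching, hfac]
  rw [Fin.prod_univ_eq_prod_range (fun i => if i < (k : ℕ) then (-1 : ℝ) else 1) m,
    Finset.prod_ite]
  simp only [Finset.prod_const, one_pow, mul_one]
  congr 1
  have : (Finset.range m).filter (fun i => i < (k : ℕ)) = Finset.range k := by
    ext i
    simp only [Finset.mem_filter, Finset.mem_range]
    omega
  rw [this, Finset.card_range]

theorem intervalIntegrable_switching_smul {E : Type*} [NormedAddCommGroup E] [NormedSpace ℝ E]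
    {F : ℝ → E} {a b : ℝ} (hF : IntervalIntegrable F volume a b) (σ : Fin m → ℝ) :
    IntervalIntegrable (fun s => switching σ s • F s) volume a b := by
  refine hF.norm.mono_fun' ((measurable_switching σ).aestronglyMeasurable.smul
    hF.def'.aestronglyMeasurable) (Filter.Eventually.of_forall fun s => ?_)
  simp only [norm_smul, Real.norm_eq_abs]
  exact mul_le_of_le_one_left (norm_nonneg _) (abs_switching_le_one σ s)

theorem sum_integral_knots {E : Type*} [NormedAddCommGroup E] [NormedSpace ℝ E]
    {t : ℝ} (ht : 0 < t) {σ : Fin m → ℝ} (hσ : σ ∈ weylChamber m t)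
    {F : ℝ → E} (hF : IntervalIntegrable F volume 0 t) :
    ∑ k : Fin (m + 1), (-1 : ℝ) ^ (k : ℕ) •
        ∫ s in (knots t σ k.castSucc)..(knots t σ k.succ), F s =
      ∫ s in (0 : ℝ)..t, switching σ s • F s := by
  have hpiece : ∀ k : Fin (m + 1), (-1 : ℝ) ^ (k : ℕ) •
      ∫ s in (knots t σ k.castSucc)..(knots t σ k.succ), F s =
      ∫ s in (knots t σ k.castSucc)..(knots t σ k.succ), switching σ s • F s := by
    intro k
    have hle := monotone_knots ht hσ (Fin.castSucc_le_succ k)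
    -- Open intervals are needed because `switching` is `0` at its switching times.
    rw [← intervalIntegral.integral_smul, intervalIntegral.integral_of_le hle,
      intervalIntegral.integral_of_le hle, integral_Ioc_eq_integral_Ioo,
      integral_Ioc_eq_integral_Ioo]
    refine setIntegral_congr_fun measurableSet_Ioo fun s hs => ?_
    simp only [switching_eq_of_mem_Ioo ht hσ k hs]
  rw [Finset.sum_congr rfl fun k _ => hpiece k]
  -- Only the indices up to `m + 1` matter; beyond them `K` wraps around.
  let K : ℕ → ℝ := fun j => knots t σ (Fin.ofNat (m + 2) j)
  have hK : ∀ k : Fin (m + 2), K k = knots t σ k := fun k => by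
    simp only [K]
    rw [Fin.ofNat_val_eq_self]
  have hsub := intervalIntegral.sum_integral_adjacent_intervals (a := K) (n := m + 1)
    (f := fun s => switching σ s • F s) (μ := volume) fun k _ =>
      (intervalIntegrable_switching_smul hF σ).mono_set (by
        rw [uIcc_of_le ht.le]
        exact uIcc_subset_Icc (knots_mem_Icc ht hσ _) (knots_mem_Icc ht hσ _))
  rw [← Fin.sum_univ_eq_sum_range
    (fun k => ∫ s in (K k)..(K (k + 1)), switching σ s • F s)] at hsub
  have h0 : K 0 = 0 := hK 0
  have hl : K (m + 1) = t := (hK (Fin.last (m + 1))).trans (knots_last t σ)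
  rw [h0, hl] at hsub
  rw [← hsub]
  refine Finset.sum_congr rfl fun k _ => ?_
  rw [← hK, ← hK]
  simp

section Range

variable {t : ℝ} {x₀ : Fin (m + 1) → ℝ} {uMin uMax : ℝ → ℝ}

theorem continuousOn_mu (h₁ : ContinuousOn uMin (Icc 0 t)) (h₂ : ContinuousOn uMax (Icc 0 t)) :
    ContinuousOn (mu uMin uMax) (Icc 0 t) := (h₂.sub h₁).div_const 2

theorem continuousOn_nu (h₁ : ContinuousOn uMin (Icc 0 t)) (h₂ : ContinuousOn uMax (Icc 0 t)) :
    ContinuousOn (nu uMin uMax) (Icc 0 t) := (h₂.add h₁).div_const 2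

theorem mem_Icc_iff_abs_sub_nu_le {s v : ℝ} :
    v ∈ Icc (uMin s) (uMax s) ↔ |v - nu uMin uMax s| ≤ mu uMin uMax s := by
  rw [abs_le, nu, mu, mem_Icc]
  constructor <;> rintro ⟨h₁, h₂⟩ <;> constructor <;> linarith

theorem continuousOn_xi_sub (t : ℝ) (S : Set ℝ) : ContinuousOn (fun s => xi m (t - s)) S :=
  (continuous_xi.comp (by fun_prop)).continuousOn

/-- The bang-bang input with leading sign `ε` and switching times `σ`. -/
noncomputable def bangBang (uMin uMax : ℝ → ℝ) (ε : ℝ) (σ : Fin m → ℝ) (s : ℝ) : ℝ :=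
  nu uMin uMax s + ε * (switching σ s * mu uMin uMax s)

theorem intervalIntegrable_bangBang (ht : 0 < t) (h₁ : ContinuousOn uMin (Icc 0 t))
    (h₂ : ContinuousOn uMax (Icc 0 t)) (ε : ℝ) (σ : Fin m → ℝ) :
    IntervalIntegrable (bangBang uMin uMax ε σ) volume 0 t := by
  rw [← uIcc_of_le ht.le] at h₁ h₂
  have hμ : IntervalIntegrable (mu uMin uMax) volume 0 t :=
    ((h₂.sub h₁).div_const 2).intervalIntegrable
  have hν : IntervalIntegrable (nu uMin uMax) volume 0 t :=
    ((h₂.add h₁).div_const 2).intervalIntegrable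
  exact hν.add ((intervalIntegrable_switching_smul hμ σ).const_mul ε)

theorem boundaryPoint_eq_endpoint (ht : 0 < t) (h₁ : ContinuousOn uMin (Icc 0 t))
    (h₂ : ContinuousOn uMax (Icc 0 t)) (ε : ℝ) {σ : Fin m → ℝ} (hσ : σ ∈ weylChamber m t) :
    boundaryPoint t x₀ uMin uMax ε σ = endpoint t x₀ (bangBang uMin uMax ε σ) := by
  have hμ : IntervalIntegrable (fun s => mu uMin uMax s • xi m (t - s)) volume 0 t := by
    apply ContinuousOn.intervalIntegrable
    rw [uIcc_of_le ht.le]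
    exact (continuousOn_mu h₁ h₂).smul (continuousOn_xi_sub t _)
  have hν : IntervalIntegrable (fun s => nu uMin uMax s • xi m (t - s)) volume 0 t := by
    apply ContinuousOn.intervalIntegrable
    rw [uIcc_of_le ht.le]
    exact (continuousOn_nu h₁ h₂).smul (continuousOn_xi_sub t _)
  rw [boundaryPoint, sum_integral_knots ht hσ hμ, endpoint, add_assoc,
    ← intervalIntegral.integral_smul, ← intervalIntegral.integral_add hν
      (show IntervalIntegrable (fun s => ε • switching σ s • mu uMin uMax s • xi m (t - s))
        volume 0 t from (intervalIntegrable_switching_smul hμ σ).smul ε)]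
  simp only [bangBang, add_smul, mul_smul]

theorem convex_integratorReachSet (ht : 0 < t) :
    Convex ℝ (integratorReachSet t x₀ uMin uMax) := by
  intro p hp q hq a b ha hb hab
  rw [mem_integratorReachSet_iff ht] at hp hq ⊢
  obtain ⟨u, hu, hub, rfl⟩ := hp
  obtain ⟨v, hv, hvb, rfl⟩ := hq
  refine ⟨fun s => a • u s + b • v s, (hu.const_smul a).add (hv.const_smul b),
    fun s hs => convex_Icc _ _ (hub s hs) (hvb s hs) ha hb hab, ?_⟩
  have hint : ∀ (c : ℝ) (w : ℝ → ℝ), ContinuousOn w (Icc 0 t) →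
      IntervalIntegrable (fun s => c • w s • xi m (t - s)) volume 0 t := fun c w hw => by
    apply ContinuousOn.intervalIntegrable
    rw [uIcc_of_le ht.le]
    exact (hw.smul (continuousOn_xi_sub t _)).const_smul c
  simp only [endpoint, add_smul, smul_assoc]
  rw [intervalIntegral.integral_add (hint a u hu) (hint b v hv),
    intervalIntegral.integral_smul, intervalIntegral.integral_smul]
  have : chi t x₀ = a • chi t x₀ + b • chi t x₀ := by rw [← add_smul, hab, one_smul]
  conv_lhs => rw [this]
  simp only [smul_add]
  abel

/-- Truncation to `[-1, 1]`. -/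
noncomputable def saturation (x : ℝ) : ℝ := max (-1) (min 1 x)

theorem abs_saturation_le_one (x : ℝ) : |saturation x| ≤ 1 :=
  abs_le.2 ⟨le_max_left _ _, max_le (by norm_num) (min_le_left _ _)⟩

theorem continuous_saturation : Continuous saturation := by
  unfold saturation
  fun_prop

theorem tendsto_saturation_mul (x : ℝ) :
    Filter.Tendsto (fun N : ℕ => saturation (N * x)) Filter.atTop (nhds (Real.sign x)) := by
  refine Filter.Tendsto.congr' ?_ tendsto_const_nhds
  rcases lt_trichotomy x 0 with h | rfl | h
  · obtain ⟨N₀, hN₀⟩ := exists_nat_gt (1 / -x)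
    filter_upwards [Filter.eventually_ge_atTop N₀] with N hN
    have : 1 / -x < N := hN₀.trans_le (by exact_mod_cast hN)
    rw [div_lt_iff₀ (by linarith)] at this
    rw [Real.sign_of_neg h, saturation, min_eq_right (by linarith), max_eq_left (by linarith)]
  · simp [saturation]
  · obtain ⟨N₀, hN₀⟩ := exists_nat_gt (1 / x)
    filter_upwards [Filter.eventually_ge_atTop N₀] with N hN
    have : 1 / x < N := hN₀.trans_le (by exact_mod_cast hN)
    rw [div_lt_iff₀ h] at this
    rw [Real.sign_of_pos h, saturation, min_eq_left (by linarith), max_eq_right (by linarith)]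

/-- Replacing each sign by a steep saturation gives admissible continuous inputs converging
pointwise to the bang-bang one; dominated convergence carries this to endpoints. -/
theorem endpoint_bangBang_mem_closure (ht : 0 < t) (h₁ : ContinuousOn uMin (Icc 0 t))
    (h₂ : ContinuousOn uMax (Icc 0 t)) (h : ∀ s ∈ Icc 0 t, uMin s ≤ uMax s)
    {ε : ℝ} (hε : ε = 1 ∨ ε = -1) (σ : Fin m → ℝ) :
    endpoint t x₀ (bangBang uMin uMax ε σ) ∈ closure (integratorReachSet t x₀ uMin uMax) := by
  have hμ := continuousOn_mu h₁ h₂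
  have hν := continuousOn_nu h₁ h₂
  have hεa : |ε| = 1 := by rcases hε with rfl | rfl <;> simp
  let w : ℕ → ℝ → ℝ := fun N s => ∏ i, saturation (N * (σ i - s))
  have hw1 : ∀ N s, |w N s| ≤ 1 := fun N s => by
    simp only [w, Finset.abs_prod]
    exact Finset.prod_le_one (fun _ _ => abs_nonneg _) fun _ _ => abs_saturation_le_one _
  have hwc : ∀ N, Continuous (w N) := fun N =>
    continuous_finsetProd _ fun i _ => continuous_saturation.comp (by fun_prop)
  have hwt : ∀ s, Filter.Tendsto (fun N => w N s) Filter.atTop (nhds (switching σ s)) :=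
    fun s => tendsto_finsetProd _ fun i _ => tendsto_saturation_mul _
  let u : ℕ → ℝ → ℝ := fun N s => nu uMin uMax s + ε * (w N s * mu uMin uMax s)
  have huc : ∀ N, ContinuousOn (u N) (Icc 0 t) := fun N =>
    hν.add (continuousOn_const.mul ((hwc N).continuousOn.mul hμ))
  have hμ0 : ∀ s ∈ Icc 0 t, 0 ≤ mu uMin uMax s := fun s hs => by
    unfold mu
    linarith [h s hs]
  have hub : ∀ N, ∀ s ∈ Icc 0 t, |u N s - nu uMin uMax s| ≤ mu uMin uMax s := by
    intro N s hs
    simp only [u, add_sub_cancel_left, abs_mul, hεa, one_mul, abs_of_nonneg (hμ0 s hs)]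
    exact mul_le_of_le_one_left (hμ0 s hs) (hw1 N s)
  refine mem_closure_of_tendsto (f := fun N => endpoint t x₀ (u N)) (b := Filter.atTop) ?_
    (Filter.Eventually.of_forall fun N => (mem_integratorReachSet_iff ht).2
      ⟨u N, huc N, fun s hs => mem_Icc_iff_abs_sub_nu_le.2 (hub N s hs), rfl⟩)
  refine Filter.Tendsto.const_add _ ?_
  have hsub : uIoc 0 t ⊆ Icc 0 t := by
    rw [uIoc_of_le ht.le]
    exact Ioc_subset_Icc_self
  refine intervalIntegral.tendsto_integral_filter_of_dominated_convergence
    (fun s => (|nu uMin uMax s| + mu uMin uMax s) * ‖xi m (t - s)‖)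
    (Filter.Eventually.of_forall fun N => ?_)
    (Filter.Eventually.of_forall fun N => Filter.Eventually.of_forall fun s hs => ?_) ?_
    (Filter.Eventually.of_forall fun s _ => ?_)
  · exact (((huc N).smul (continuousOn_xi_sub t _)).mono hsub).aestronglyMeasurable
      measurableSet_uIoc
  · rw [norm_smul, Real.norm_eq_abs]
    refine mul_le_mul_of_nonneg_right ?_ (norm_nonneg _)
    have := hub N s (hsub hs)
    have h3 := abs_add_le (nu uMin uMax s) (u N s - nu uMin uMax s)
    rw [add_sub_cancel] at h3
    linarith
  · apply ContinuousOn.intervalIntegrable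
    rw [uIcc_of_le ht.le]
    exact (hν.abs.add hμ).mul (continuousOn_xi_sub t _).norm
  · exact ((((hwt s).mul_const _).const_mul ε).const_add _).smul_const _

end Range

end

/-! ### Optimality and stability of bang-bang endpoints -/

section

variable {m : ℕ} {t : ℝ} {x₀ : Fin (m + 1) → ℝ} {uMin uMax : ℝ → ℝ}

theorem endpoint_sub_endpoint {w v : ℝ → ℝ} (hw : IntervalIntegrable w volume 0 t)
    (hv : IntervalIntegrable v volume 0 t) :
    endpoint t x₀ w - endpoint t x₀ v = ∫ s in (0 : ℝ)..t, (w s - v s) • xi m (t - s) := by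
  simp only [endpoint, add_sub_add_left_eq_sub, sub_smul]
  rw [intervalIntegral.integral_sub (hw.smul_continuousOn (continuousOn_xi_sub t _))
    (hv.smul_continuousOn (continuousOn_xi_sub t _))]

theorem functional_endpoint_sub (f : StrongDual ℝ (Fin (m + 1) → ℝ)) {w v : ℝ → ℝ}
    (hw : IntervalIntegrable w volume 0 t) (hv : IntervalIntegrable v volume 0 t) :
    f (endpoint t x₀ w) - f (endpoint t x₀ v) =
      ∫ s in (0 : ℝ)..t, (w s - v s) * f (xi m (t - s)) := by
  rw [← map_sub, endpoint_sub_endpoint hw hv, ← ContinuousLinearMap.intervalIntegral_comp_comm]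
  · simp
  · exact (hw.sub hv).smul_continuousOn (continuousOn_xi_sub t _)

theorem bang_sub_mul_eq_abs {ν μ v g : ℝ} (h : |v - ν| ≤ μ) :
    (ν + μ * Real.sign g - v) * g = |ν + μ * Real.sign g - v| * |g| := by
  rw [abs_le] at h
  rcases lt_trichotomy g 0 with hg | rfl | hg
  · rw [Real.sign_of_neg hg, abs_of_neg hg, abs_of_nonpos (by linarith)]
    ring
  · simp
  · rw [Real.sign_of_pos hg, abs_of_pos hg, abs_of_nonneg (by linarith)]

/-- The bang-bang value lies at the end of the range favoured by the sign of `f (xi m (t - s))`, so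
the integrand is nonnegative. The exact formula, not only the inequality, feeds the stability
estimate. -/
theorem functional_bangBang_sub (ht : 0 < t) (h₁ : ContinuousOn uMin (Icc 0 t))
    (h₂ : ContinuousOn uMax (Icc 0 t)) {ε : ℝ} {σ : Fin m → ℝ}
    {f : StrongDual ℝ (Fin (m + 1) → ℝ)}
    (hf : ∀ s ∈ Ico 0 t, Real.sign (f (xi m (t - s))) = ε * switching σ s)
    {u : ℝ → ℝ} (hu : ContinuousOn u (Icc 0 t))
    (hub : ∀ s ∈ Icc 0 t, u s ∈ Icc (uMin s) (uMax s)) :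
    f (endpoint t x₀ (bangBang uMin uMax ε σ)) - f (endpoint t x₀ u) =
      ∫ s in (0 : ℝ)..t, |bangBang uMin uMax ε σ s - u s| * |f (xi m (t - s))| := by
  rw [functional_endpoint_sub f (intervalIntegrable_bangBang ht h₁ h₂ ε σ)
    (by rw [← uIcc_of_le ht.le] at hu; exact hu.intervalIntegrable),
    intervalIntegral.integral_of_le ht.le, intervalIntegral.integral_of_le ht.le,
    integral_Ioc_eq_integral_Ioo, integral_Ioc_eq_integral_Ioo]
  refine setIntegral_congr_fun measurableSet_Ioo fun s hs => ?_
  have hb : bangBang uMin uMax ε σ s =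
      nu uMin uMax s + mu uMin uMax s * Real.sign (f (xi m (t - s))) := by
    rw [hf s (Ioo_subset_Ico_self hs), bangBang]
    ring
  simp only [hb]
  exact bang_sub_mul_eq_abs (mem_Icc_iff_abs_sub_nu_le.1 (hub s (Ioo_subset_Icc_self hs)))

theorem functional_le_bangBang (ht : 0 < t) (h₁ : ContinuousOn uMin (Icc 0 t))
    (h₂ : ContinuousOn uMax (Icc 0 t)) {ε : ℝ} {σ : Fin m → ℝ}
    {f : StrongDual ℝ (Fin (m + 1) → ℝ)}
    (hf : ∀ s ∈ Ico 0 t, Real.sign (f (xi m (t - s))) = ε * switching σ s)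
    {p : Fin (m + 1) → ℝ} (hp : p ∈ integratorReachSet t x₀ uMin uMax) :
    f p ≤ f (endpoint t x₀ (bangBang uMin uMax ε σ)) := by
  obtain ⟨u, hu, hub, rfl⟩ := (mem_integratorReachSet_iff ht).1 hp
  rw [← sub_nonneg, functional_bangBang_sub ht h₁ h₂ hf hu hub]
  exact intervalIntegral.integral_nonneg ht.le fun s _ => by positivity

theorem endpoint_bangBang_mem_frontier (ht : 0 < t) (h₁ : ContinuousOn uMin (Icc 0 t))
    (h₂ : ContinuousOn uMax (Icc 0 t)) (h : ∀ s ∈ Icc 0 t, uMin s ≤ uMax s)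
    {ε : ℝ} (hε : ε = 1 ∨ ε = -1) (σ : Fin m → ℝ) :
    endpoint t x₀ (bangBang uMin uMax ε σ) ∈ frontier (integratorReachSet t x₀ uMin uMax) := by
  obtain ⟨f, hf0, hf⟩ := exists_functional_sign_eq_switching (t := t) hε σ
  exact ⟨endpoint_bangBang_mem_closure ht h₁ h₂ h hε σ,
    notMem_interior_of_forall_le hf0 fun p hp =>
      functional_le_bangBang ht h₁ h₂ (fun s _ => hf s) hp⟩

/-- If `g` is nonzero almost everywhere, then `δ / (|g| + δ)` tends to `0` in mean. -/
theorem tendsto_integral_div_abs_add {g : ℝ → ℝ} (hg : Continuous g)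
    (hne : ∀ᵐ s, g s ≠ 0) :
    Filter.Tendsto (fun δ : ℝ => ∫ s in (0 : ℝ)..t, δ / (|g s| + δ)) (nhdsWithin 0 (Ioi 0))
      (nhds 0) := by
  have hpos : ∀ᶠ δ : ℝ in nhdsWithin 0 (Ioi 0), 0 < δ := self_mem_nhdsWithin
  have := intervalIntegral.tendsto_integral_filter_of_dominated_convergence (a := 0) (b := t)
    (μ := volume) (l := nhdsWithin (0 : ℝ) (Ioi 0)) (F := fun δ s => δ / (|g s| + δ))
    (f := fun _ => (0 : ℝ)) (fun _ => 1) ?_ ?_ intervalIntegrable_const ?_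
  · simpa using this
  · exact Filter.Eventually.of_forall fun δ =>
      (measurable_const.div (hg.measurable.abs.add_const δ)).aestronglyMeasurable
  · filter_upwards [hpos] with δ hδ
    refine Filter.Eventually.of_forall fun s _ => ?_
    rw [Real.norm_eq_abs, abs_of_nonneg (by positivity), div_le_one (by positivity)]
    linarith [abs_nonneg (g s)]
  · filter_upwards [hne] with s hs _
    have hc : ContinuousAt (fun δ : ℝ => δ / (|g s| + δ)) 0 :=
      ContinuousAt.div (by fun_prop) (by fun_prop) (by simpa using hs)
    have := hc.tendsto
    simp only [zero_div] at this
    exact this.mono_left nhdsWithin_le_nhds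

/-- The gap in `f` controls the input difference `d` only with weight `g = |f (xi m (t - s))|`.
Where `g` is large compared with `δ` the weight is divided out; elsewhere `d` is merely bounded, at
a cost that vanishes as `δ → 0` when `g ≠ 0` almost everywhere. `K` and `B` do not depend on `p` or
`δ`. -/
theorem norm_endpoint_bangBang_sub_le (ht : 0 < t) (h₁ : ContinuousOn uMin (Icc 0 t))
    (h₂ : ContinuousOn uMax (Icc 0 t)) {ε : ℝ} (hε : ε = 1 ∨ ε = -1) {σ : Fin m → ℝ}
    {f : StrongDual ℝ (Fin (m + 1) → ℝ)}
    (hf : ∀ s ∈ Ico 0 t, Real.sign (f (xi m (t - s))) = ε * switching σ s) :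
    ∃ K B : ℝ, 0 ≤ K ∧ ∀ p ∈ integratorReachSet t x₀ uMin uMax, ∀ δ > 0,
      ‖endpoint t x₀ (bangBang uMin uMax ε σ) - p‖ ≤
        K * (δ⁻¹ * (f (endpoint t x₀ (bangBang uMin uMax ε σ)) - f p) +
          B * ∫ s in (0 : ℝ)..t, δ / (|f (xi m (t - s))| + δ)) := by
  obtain ⟨K, hK⟩ := isCompact_Icc.exists_bound_of_continuousOn
    (continuousOn_xi_sub (m := m) t (Icc 0 t))
  obtain ⟨B, hB⟩ := isCompact_Icc.exists_bound_of_continuousOn (continuousOn_mu h₁ h₂)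
  have hK0 : 0 ≤ K := (norm_nonneg _).trans (hK 0 ⟨le_rfl, ht.le⟩)
  have hεa : |ε| = 1 := by rcases hε with rfl | rfl <;> simp
  refine ⟨K, 2 * B, hK0, fun p hp δ hδ => ?_⟩
  obtain ⟨u, hu, hub, rfl⟩ := (mem_integratorReachSet_iff ht).1 hp
  have hui : IntervalIntegrable u volume 0 t := by
    rw [← uIcc_of_le ht.le] at hu
    exact hu.intervalIntegrable
  have hbi := intervalIntegrable_bangBang ht h₁ h₂ ε σ
  have hgc : Continuous fun s => f (xi m (t - s)) :=
    f.continuous.comp (continuous_xi.comp (by fun_prop))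
  have hdi : IntervalIntegrable (fun s => |bangBang uMin uMax ε σ s - u s|) volume 0 t :=
    (hbi.sub hui).abs
  have hi₁ : IntervalIntegrable
      (fun s => |bangBang uMin uMax ε σ s - u s| * |f (xi m (t - s))|) volume 0 t :=
    hdi.mul_continuousOn hgc.abs.continuousOn
  have hi₂ : IntervalIntegrable (fun s => δ / (|f (xi m (t - s))| + δ)) volume 0 t :=
    (continuous_const.div (hgc.abs.add continuous_const)
      fun s => (add_pos_of_nonneg_of_pos (abs_nonneg _) hδ).ne').intervalIntegrable _ _
  have hbound : ∀ s ∈ Icc 0 t, |bangBang uMin uMax ε σ s - u s| ≤ 2 * B := by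
    intro s hs
    have h3 := mem_Icc_iff_abs_sub_nu_le.1 (hub s hs)
    have h4 : mu uMin uMax s ≤ B := (le_abs_self _).trans (hB s hs)
    have h5 : |bangBang uMin uMax ε σ s - nu uMin uMax s| ≤ mu uMin uMax s := by
      rw [bangBang, add_sub_cancel_left, abs_mul, hεa, one_mul, abs_mul,
        abs_of_nonneg ((abs_nonneg _).trans h3)]
      exact mul_le_of_le_one_left ((abs_nonneg _).trans h3) (abs_switching_le_one σ s)
    calc _ ≤ |bangBang uMin uMax ε σ s - nu uMin uMax s| + |nu uMin uMax s - u s| :=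
          abs_sub_le _ _ _
      _ ≤ 2 * B := by rw [abs_sub_comm (nu uMin uMax s)]; linarith
  rw [functional_bangBang_sub ht h₁ h₂ hf hu hub, endpoint_sub_endpoint hbi hui,
    ← intervalIntegral.integral_const_mul, ← intervalIntegral.integral_const_mul,
    ← intervalIntegral.integral_add (hi₁.const_mul _) (hi₂.const_mul _),
    ← intervalIntegral.integral_const_mul]
  refine (intervalIntegral.norm_integral_le_integral_norm ht.le).trans
    (intervalIntegral.integral_mono_on ht.le
      ((hbi.sub hui).smul_continuousOn (continuousOn_xi_sub t _)).norm
      (((hi₁.const_mul _).add (hi₂.const_mul _)).const_mul K) fun s hs => ?_)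
  rw [norm_smul, Real.norm_eq_abs, mul_comm]
  set d := |bangBang uMin uMax ε σ s - u s|
  set g := |f (xi m (t - s))|
  have hd : 0 ≤ d := abs_nonneg _
  have hg : 0 ≤ g := abs_nonneg _
  refine mul_le_mul (hK s hs) ?_ hd hK0
  have hsplit : d = d * g / (g + δ) + d * (δ / (g + δ)) := by
    field_simp
  have h6 : d * g / (g + δ) ≤ δ⁻¹ * (d * g) := by
    rw [div_eq_inv_mul]
    gcongr
    linarith
  have h7 : d * (δ / (g + δ)) ≤ 2 * B * (δ / (g + δ)) :=
    mul_le_mul_of_nonneg_right (hbound s hs) (by positivity)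
  linarith

theorem exists_bangBang_of_mem_frontier (ht : 0 < t) (h₁ : ContinuousOn uMin (Icc 0 t))
    (h₂ : ContinuousOn uMax (Icc 0 t)) (h : ∀ s ∈ Icc 0 t, uMin s ≤ uMax s)
    {y : Fin (m + 1) → ℝ} (hy : y ∈ frontier (integratorReachSet t x₀ uMin uMax)) :
    ∃ ε : ℝ, (ε = 1 ∨ ε = -1) ∧ ∃ σ ∈ weylChamber m t,
      endpoint t x₀ (bangBang uMin uMax ε σ) = y := by
  obtain ⟨f, hf0, hfy⟩ := exists_supporting_functional (convex_integratorReachSet ht) hy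
  obtain ⟨q, hq0, hqd, hq⟩ := exists_polynomial_of_functional f hf0
  obtain ⟨ε, hε, σ', hσ', hs⟩ := exists_real_sign_eval_eq_switching ht m q hq0 hqd
  let σ : Fin m → ℝ := σ' ∘ Tuple.sort σ'
  have hσ : σ ∈ weylChamber m t := ⟨Tuple.monotone_sort σ', fun i => hσ' _⟩
  have hf : ∀ s ∈ Ico 0 t, Real.sign (f (xi m (t - s))) = ε * switching σ s := fun s hst => by
    rw [hq, hs s hst, switching_comp_perm]
  refine ⟨ε, hε, σ, hσ, ?_⟩
  set z := endpoint t x₀ (bangBang uMin uMax ε σ)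
  have hzy : f z ≤ f y :=
    closure_minimal hfy (isClosed_Iic.preimage f.continuous)
      (endpoint_bangBang_mem_closure ht h₁ h₂ h hε σ)
  obtain ⟨K, B, hK, hle⟩ := norm_endpoint_bangBang_sub_le (x₀ := x₀) ht h₁ h₂ hε hf
  have hle' : ∀ δ > 0, ‖z - y‖ ≤ K * (B * ∫ s in (0 : ℝ)..t, δ / (|f (xi m (t - s))| + δ)) := by
    intro δ hδ
    -- For fixed `δ` the estimate is a closed condition on `p`, so it passes to the limit point `y`,
    -- where `f z ≤ f y` removes the term with `δ⁻¹`.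
    have hclosed : IsClosed {p | ‖z - p‖ ≤ K * (δ⁻¹ * (f z - f p) +
        B * ∫ s in (0 : ℝ)..t, δ / (|f (xi m (t - s))| + δ))} :=
      isClosed_le (by fun_prop) (by fun_prop)
    have hcl := closure_minimal (fun p hp => hle p hp δ hδ) hclosed hy.1
    refine (show _ ≤ _ from hcl).trans (mul_le_mul_of_nonneg_left ?_ hK)
    have : δ⁻¹ * (f z - f y) ≤ 0 :=
      mul_nonpos_of_nonneg_of_nonpos (by positivity) (by linarith)
    linarith
  have hne : ∀ᵐ s : ℝ, f (xi m (t - s)) ≠ 0 := by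
    have hfin : {s : ℝ | q.IsRoot (t - s)}.Finite :=
      (Polynomial.finite_setOfPred_isRoot hq0).preimage (sub_right_injective.injOn)
    have := hfin.countable.ae_notMem volume
    filter_upwards [this] with s hs
    rw [hq]
    exact hs
  have hlim := ((tendsto_integral_div_abs_add (t := t)
    (f.continuous.comp (continuous_xi.comp (continuous_const.sub continuous_id)))
    hne).const_mul B).const_mul K
  rw [mul_zero, mul_zero] at hlim
  have : ‖z - y‖ ≤ 0 := ge_of_tendsto hlim
    (Filter.mem_of_superset self_mem_nhdsWithin fun δ hδ => hle' δ hδ)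
  exact sub_eq_zero.1 (norm_le_zero_iff.1 this)

theorem frontier_integratorReachSet (ht : 0 < t) (h₁ : ContinuousOn uMin (Icc 0 t))
    (h₂ : ContinuousOn uMax (Icc 0 t)) (h : ∀ s ∈ Icc 0 t, uMin s ≤ uMax s) :
    frontier (integratorReachSet t x₀ uMin uMax) =
      boundaryPoint t x₀ uMin uMax 1 '' weylChamber m t ∪
        boundaryPoint t x₀ uMin uMax (-1) '' weylChamber m t := by
  apply Subset.antisymm
  · intro y hy
    obtain ⟨ε, hε, σ, hσ, rfl⟩ := exists_bangBang_of_mem_frontier ht h₁ h₂ h hy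
    rw [← boundaryPoint_eq_endpoint ht h₁ h₂ ε hσ]
    rcases hε with rfl | rfl
    · exact Or.inl ⟨σ, hσ, rfl⟩
    · exact Or.inr ⟨σ, hσ, rfl⟩
  · rintro _ (⟨σ, hσ, rfl⟩ | ⟨σ, hσ, rfl⟩)
    · rw [boundaryPoint_eq_endpoint ht h₁ h₂ 1 hσ]
      exact endpoint_bangBang_mem_frontier ht h₁ h₂ h (Or.inl rfl) σ
    · rw [boundaryPoint_eq_endpoint ht h₁ h₂ (-1) hσ]
      exact endpoint_bangBang_mem_frontier ht h₁ h₂ h (Or.inr rfl) σ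

end

/-! ### Continuity and ordering of the LTI input range -/

section

variable {m : ℕ}

open scoped Matrix.Norms.Operator in
theorem continuous_exp_smul_mulVec (M : Matrix (Fin (m + 1)) (Fin (m + 1)) ℝ)
    (c x : Fin (m + 1) → ℝ) :
    Continuous fun s : ℝ => c ⬝ᵥ (NormedSpace.exp (s • M) *ᵥ x) := by
  have h : Continuous fun s : ℝ => NormedSpace.exp (s • M) :=
    NormedSpace.exp_continuous.comp (continuous_id.smul continuous_const)
  exact continuous_const.dotProduct (h.matrix_mulVec continuous_const)

section LTI

variable (A : Matrix (Fin (m + 1)) (Fin (m + 1)) ℝ)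

theorem kernelF_eq_sub (s τ : ℝ) : kernelF A s τ = kernelF A (s - τ) 0 := by
  simp [kernelF]

theorem continuous_kernelF_zero : Continuous fun s => kernelF A s 0 := by
  simpa [kernelF] using continuous_exp_smul_mulVec (aCon A) (charCoeffs A) (bCon m)

theorem continuous_kernelF (s : ℝ) : Continuous (kernelF A s) := by
  have := (continuous_kernelF_zero A).comp (continuous_const.sub continuous_id : Continuous (s - ·))
  exact this.congr fun τ => (kernelF_eq_sub A s τ).symm

/-- The substitution `w = s - τ` removes `s` from the kernel and from its sublevel set, leaving a
primitive of a fixed continuous function. Continuity in `s` follows. -/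
theorem integral_subLevel {s : ℝ} (hs : 0 ≤ s) :
    ∫ τ in subLevel A s, kernelF A s τ = ∫ w in (0 : ℝ)..s, min (kernelF A w 0) 0 := by
  have hset : subLevel A s = Icc 0 s ∩ {τ | kernelF A s τ ≤ 0} := rfl
  have hm : MeasurableSet {τ | kernelF A s τ ≤ 0} :=
    (isClosed_le (continuous_kernelF A s) continuous_const).measurableSet
  rw [hset, ← setIntegral_indicator hm, integral_Icc_eq_integral_Ioc,
    ← intervalIntegral.integral_of_le hs]
  have := intervalIntegral.integral_comp_sub_left (fun w => min (kernelF A w 0) 0) (a := 0)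
    (b := s) s
  rw [sub_self, sub_zero] at this
  rw [← this]
  refine intervalIntegral.integral_congr fun τ _ => ?_
  simp only [indicator, mem_ofPred_eq, ← kernelF_eq_sub]
  split_ifs with h
  · exact (min_eq_left h).symm
  · exact (min_eq_right (not_le.1 h).le).symm

theorem integral_superLevel {s : ℝ} (hs : 0 ≤ s) :
    ∫ τ in superLevel A s, kernelF A s τ = ∫ w in (0 : ℝ)..s, max (kernelF A w 0) 0 := by
  have hset : superLevel A s = Icc 0 s ∩ {τ | 0 < kernelF A s τ} := rfl
  have hm : MeasurableSet {τ | 0 < kernelF A s τ} :=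
    (isOpen_lt continuous_const (continuous_kernelF A s)).measurableSet
  rw [hset, ← setIntegral_indicator hm, integral_Icc_eq_integral_Ioc,
    ← intervalIntegral.integral_of_le hs]
  have := intervalIntegral.integral_comp_sub_left (fun w => max (kernelF A w 0) 0) (a := 0)
    (b := s) s
  rw [sub_self, sub_zero] at this
  rw [← this]
  refine intervalIntegral.integral_congr fun τ _ => ?_
  simp only [indicator, mem_ofPred_eq, ← kernelF_eq_sub]
  split_ifs with h
  · exact (max_eq_left h.le).symm
  · exact (max_eq_right (not_lt.1 h)).symm

theorem continuousOn_integral_subLevel (t : ℝ) :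
    ContinuousOn (fun s => ∫ τ in subLevel A s, kernelF A s τ) (Icc 0 t) := by
  have hc : Continuous fun w => min (kernelF A w 0) 0 :=
    (continuous_kernelF_zero A).min continuous_const
  exact (intervalIntegral.continuous_primitive (fun a b => hc.intervalIntegrable a b)
    0).continuousOn.congr fun s hs => integral_subLevel A hs.1

theorem continuousOn_integral_superLevel (t : ℝ) :
    ContinuousOn (fun s => ∫ τ in superLevel A s, kernelF A s τ) (Icc 0 t) := by
  have hc : Continuous fun w => max (kernelF A w 0) 0 :=
    (continuous_kernelF_zero A).max continuous_const
  exact (intervalIntegral.continuous_primitive (fun a b => hc.intervalIntegrable a b)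
    0).continuousOn.congr fun s hs => integral_superLevel A hs.1

variable (b z₀ : Fin (m + 1) → ℝ) (vMin vMax t : ℝ)

theorem continuousOn_uMinLTI : ContinuousOn (uMinLTI A b z₀ vMin vMax) (Icc 0 t) :=
  (continuous_exp_smul_mulVec _ _ _).neg.continuousOn.add
    ((continuousOn_const.sub
      (continuousOn_const.mul (continuousOn_integral_subLevel A t))).sub
      (continuousOn_const.mul (continuousOn_integral_superLevel A t)))

theorem continuousOn_uMaxLTI : ContinuousOn (uMaxLTI A b z₀ vMin vMax) (Icc 0 t) :=
  (continuous_exp_smul_mulVec _ _ _).neg.continuousOn.add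
    ((continuousOn_const.sub
      (continuousOn_const.mul (continuousOn_integral_subLevel A t))).sub
      (continuousOn_const.mul (continuousOn_integral_superLevel A t)))

variable {vMin vMax}

/-- The width equals `(vMax - vMin) * (1 - I₋ + I₊)`, with `I₋ ≤ 0 ≤ I₊` the integrals over the
sublevel and superlevel sets. -/
theorem uMinLTI_le_uMaxLTI (hv : vMin ≤ vMax) {s : ℝ} (hs : 0 ≤ s) :
    uMinLTI A b z₀ vMin vMax s ≤ uMaxLTI A b z₀ vMin vMax s := by
  have h₁ : ∫ τ in subLevel A s, kernelF A s τ ≤ 0 := by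
    rw [integral_subLevel A hs]
    have := intervalIntegral.integral_nonneg (μ := volume) hs
      (f := fun w => -min (kernelF A w 0) 0) fun w _ => neg_nonneg.2 (min_le_right _ _)
    rwa [intervalIntegral.integral_neg, neg_nonneg] at this
  have h₂ : 0 ≤ ∫ τ in superLevel A s, kernelF A s τ := by
    rw [integral_superLevel A hs]
    exact intervalIntegral.integral_nonneg hs fun w _ => le_max_right _ _
  rw [uMinLTI, uMaxLTI, iMin, iMax]
  nlinarith [mul_nonneg (sub_nonneg.2 hv) (neg_nonneg.2 h₁), mul_nonneg (sub_nonneg.2 hv) h₂]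

end LTI

end

end LTIReach

/-- The boundary of the integrator reach set is swept out by the two parametric surfaces over the
Weyl chamber: for every continuous time-varying input range, and in particular for the range
induced by a controllable LTI system with constant input bounds. -/
theorem theorem2 (m : ℕ) (t : ℝ) (ht : 0 < t) :
    (∀ (x₀ : Fin (m + 1) → ℝ) (uMin uMax : ℝ → ℝ),
      ContinuousOn uMin (Set.Icc 0 t) → ContinuousOn uMax (Set.Icc 0 t) →
      (∀ s ∈ Set.Icc 0 t, uMin s ≤ uMax s) →
      frontier (LTIReach.integratorReachSet t x₀ uMin uMax) =
        LTIReach.boundaryPoint t x₀ uMin uMax 1 '' LTIReach.weylChamber m t ∪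
        LTIReach.boundaryPoint t x₀ uMin uMax (-1) '' LTIReach.weylChamber m t) ∧
    (∀ (A : Matrix (Fin (m + 1)) (Fin (m + 1)) ℝ) (b z₀ : Fin (m + 1) → ℝ) (vMin vMax : ℝ),
      LTIReach.IsControllable A b → vMin ≤ vMax →
      frontier (LTIReach.integratorReachSet t (Matrix.mulVec (LTIReach.toCanonical A b) z₀)
          (LTIReach.uMinLTI A b z₀ vMin vMax) (LTIReach.uMaxLTI A b z₀ vMin vMax)) =
        LTIReach.boundaryPoint t (Matrix.mulVec (LTIReach.toCanonical A b) z₀)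
          (LTIReach.uMinLTI A b z₀ vMin vMax) (LTIReach.uMaxLTI A b z₀ vMin vMax) 1 ''
            LTIReach.weylChamber m t ∪
        LTIReach.boundaryPoint t (Matrix.mulVec (LTIReach.toCanonical A b) z₀)
          (LTIReach.uMinLTI A b z₀ vMin vMax) (LTIReach.uMaxLTI A b z₀ vMin vMax) (-1) ''
            LTIReach.weylChamber m t) := by
  refine ⟨fun x₀ uMin uMax h₁ h₂ h => LTIReach.frontier_integratorReachSet ht h₁ h₂ h,
    fun A b z₀ vMin vMax _ hv => LTIReach.frontier_integratorReachSet ht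
      (LTIReach.continuousOn_uMinLTI A b z₀ vMin vMax t)
      (LTIReach.continuousOn_uMaxLTI A b z₀ vMin vMax t)
      fun s hs => LTIReach.uMinLTI_le_uMaxLTI A b z₀ hv hs.1⟩
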